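/- **Setting.** For $p\in\mathbb R$ and $R_A,R_B\ge 0$, the single-battlefield General Lotto game with favoritism $\text{GL-F}(p,R_A,R_B)$ is the following simultaneous-move game. Player $i\in\{A,B\}$ chooses a probability distribution $F_i$ on $[0,\infty)$ with mean at most $R_i$; the payoffs are $U_A=\Pr_{x_A\sim F_A,\,x_B\sim F_B\text{ independent}}[x_A+p\ge x_B]$ and $U_B=1-U_A$. Let $\pi_A^*(p,R_A,R_B)$ denote player $A$'s payoff in a Nash equilibrium. Fix a per-unit cost $c_B\in(0,1)$ of player $B$ and a strategy $(p_A,R_A)$ of player $A$ with $p_A>0$ (pre-allocated resources) and $R_A>0$ (real-time resources; $R_A=M_A-c_Ap_A$ when player $A$ has monetary budget $M_A$ and per-unit cost $c_A$). If player $B$ has monetary budget $M_B\ge 0$ and pre-allocates $p_B\in[0,M_B/c_B]$, its payoff in the Stackelberg game is $$u_B(p_A,p_B)=1-\pi_A^*(p_A-p_B,\;R_A,\;M_B-c_Bp_B).$$ Put $R_B=M_B-c_Bp_B$, $f_A=R_A+\sqrt{R_A(R_A+2(p_A-p_B))}$, $f_B=\sqrt{R_B}$, $g_B=\sqrt{R_B+2(p_B-p_A)}$,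 and $$u_B^{1A}(p_A,p_B)=\frac{R_B}{2R_A}\Big(\frac{f_A}{p_A-p_B+f_A}\Big)^2,\qquad u_B^{1B}(p_A,p_B)=1-\frac{R_A}{2}\Big(\frac{f_B+g_B}{p_B-p_A+f_B(f_B+g_B)}\Big)^2,$$ $$\hat p_B=\frac{M_B}{c_B}-\frac{M_B-c_Bp_A}{2-c_B}.$$ **Statement.** There is exactly one number $$h=h(R_A,p_A)\in\Big(R_A+p_A,\;p_A+\frac{R_A+\sqrt{R_A(R_A+2p_A)}}{2}\Big)$$ (depending also on $c_B$, but not on $M_B$) such that $u_B^{1A}(p_A,0)=u_B^{1B}(p_A,\hat p_B)$ holds when $M_B/c_B=h$. For every $M_B\ge 0$, the game $\text{GL-F}(p_A-p_B,R_A,M_B-c_Bp_B)$ has a Nash equilibrium and a unique equilibrium payoff for each $p_B\in[0,M_B/c_B]$, so that $u_B(p_A,\cdot)$ is well defined on $[0,M_B/c_B]$, and $$\operatorname*{arg\,max}_{p_B\in[0,M_B/c_B]}u_B(p_A,p_B)=\begin{cases}\{0\}&\text{if } M_B/c_B<h,\\ \{\hat p_B\}&\text{if } M_B/c_B>h,\\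 \{0,\hat p_B\}&\text{if } M_B/c_B=h.\end{cases}$$ -/

import Mathlib

open MeasureTheory

noncomputable section

namespace GeneralLotto

/-- Mixed strategies in a single-battlefield General Lotto game with budget `R`: probability
measures on the nonnegative reals whose expected expenditure is at most `R`. -/
def strategies (R : ℝ) : Set (Measure ℝ) :=
  {F | IsProbabilityMeasure F ∧ F (Set.Iio 0) = 0 ∧
    ∫⁻ x, ENNReal.ofReal x ∂F ≤ ENNReal.ofReal R}

/-- Expected payoff to player A on one battlefield of unit value with favoritism `p` towards A
(`p` may be negative) when the players draw `x_A ∼ FA` and `x_B ∼ FB` independently: the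
probability that `x_A + p ≥ x_B`. -/
def payoffA (p : ℝ) (FA FB : Measure ℝ) : ℝ :=
  (FA.prod FB).real {z : ℝ × ℝ | z.2 ≤ z.1 + p}

/-- Expected payoff to player B; the game has constant sum `1`. -/
def payoffB (p : ℝ) (FA FB : Measure ℝ) : ℝ := 1 - payoffA p FA FB

/-- Nash equilibria of the single-battlefield General Lotto game with favoritism
`GL-F(p, RA, RB)`. -/
def IsNash (p RA RB : ℝ) (FA FB : Measure ℝ) : Prop :=
  FA ∈ strategies RA ∧ FB ∈ strategies RB ∧
    (∀ GA ∈ strategies RA, payoffA p GA FB ≤ payoffA p FA FB) ∧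
    (∀ GB ∈ strategies RB, payoffB p FA GB ≤ payoffB p FA FB)

/-- `v` is player A's payoff in some Nash equilibrium of `GL-F(p, RA, RB)`. -/
def IsEquilibriumPayoffA (p RA RB v : ℝ) : Prop :=
  ∃ FA FB : Measure ℝ, IsNash p RA RB FA FB ∧ payoffA p FA FB = v

/-- Player A's equilibrium payoff `π_A^*(p, RA, RB)` in `GL-F(p, RA, RB)`. It is the element of
the set of equilibrium payoffs whenever that set has exactly one element. -/
def eqPayoffA (p RA RB : ℝ) : ℝ := sSup {v | IsEquilibriumPayoffA p RA RB v}

/-- Player B's payoff `u_B(p_A, p_B)` in the Stackelberg game, where player A has pre-allocated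
`pA` and keeps the real-time budget `RA`, and player B, with monetary budget `MB` and per-unit
cost `cB`, pre-allocates `pB` and keeps the real-time budget `MB - cB * pB`. -/
def uB (RA MB cB pA pB : ℝ) : ℝ := 1 - eqPayoffA (pA - pB) RA (MB - cB * pB)

/-- Player B's best responses: the maximizers of `u_B(p_A, ·)` over `[0, MB / cB]`. -/
def bestResponseB (RA MB cB pA : ℝ) : Set ℝ :=
  {pB | pB ∈ Set.Icc 0 (MB / cB) ∧ IsMaxOn (uB RA MB cB pA) (Set.Icc 0 (MB / cB)) pB}

def fA (RA pA pB : ℝ) : ℝ := RA + √(RA * (RA + 2 * (pA - pB)))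

def fB (MB cB pB : ℝ) : ℝ := √(MB - cB * pB)

def gB (MB cB pA pB : ℝ) : ℝ := √(MB - cB * pB + 2 * (pB - pA))

/-- The closed-form expression `u_B^{1A}(p_A, p_B)`. -/
def uB1A (RA MB cB pA pB : ℝ) : ℝ :=
  (MB - cB * pB) / (2 * RA) * (fA RA pA pB / (pA - pB + fA RA pA pB)) ^ 2

/-- The closed-form expression `u_B^{1B}(p_A, p_B)`. -/
def uB1B (RA MB cB pA pB : ℝ) : ℝ :=
  1 - RA / 2 * ((fB MB cB pB + gB MB cB pA pB) /
    (pB - pA + fB MB cB pB * (fB MB cB pB + gB MB cB pA pB))) ^ 2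

/-- The candidate response `p̂_B`. -/
def pHatB (MB cB pA : ℝ) : ℝ := MB / cB - (MB - cB * pA) / (2 - cB)

/-- The open interval containing the threshold. -/
def thresholdInterval (RA pA : ℝ) : Set ℝ :=
  Set.Ioo (RA + pA) (pA + (RA + √(RA * (RA + 2 * pA))) / 2)

/-- `m` is a value of the ratio `MB / cB` in the threshold interval (so `MB = cB * m`) at which
`u_B^{1A}(p_A, 0) = u_B^{1B}(p_A, p̂_B)`. -/
def IsThreshold (RA cB pA m : ℝ) : Prop :=
  m ∈ thresholdInterval RA pA ∧
    uB1A RA (cB * m) cB pA 0 = uB1B RA (cB * m) cB pA (pHatB (cB * m) cB pA)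

end GeneralLotto

end

/-!
A player facing an opponent whose bid has a distribution function dominated by an affine function
`a + b * x` wins with probability at most `a + b * R`, whatever its strategy of mean at most `R`.
Mixtures of the bid `0` with a uniform bid attain such bounds for both players, which yields the
value of every game `GL-F`.

In the Stackelberg game put `y = M_B / c_B - p_A`. As long as `p_B ≤ p_A` and player B sometimes
gives up, `p_B` enters B's payoff only through the bid length `ℓ = f_A`, and the payoff is a
quadratic polynomial in `1 / ℓ`, which increases with `ℓ` when `2 * y ≤ ℓ`; since `ℓ` decreases in
`p_B`, such a response is worse than `p_B = 0`. Every other positive response earns at most the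
payoff of `p̂_B`, or less than the payoff of `0`. Hence only `0` and `p̂_B` compete, and the
difference of their payoffs is, up to a positive factor, a function of `y` that is strictly
increasing on the relevant range and changes sign exactly once.
-/

namespace GeneralLotto

lemma setOf_isMaxOn_eq {α β : Type*} [Preorder β] {s t : Set α} {u : α → β} {v : β}
    (hts : t ⊆ s) (ht : t.Nonempty) (heq : ∀ x ∈ t, u x = v) (hlt : ∀ x ∈ s \ t, u x < v) :
    {x | x ∈ s ∧ IsMaxOn u s x} = t := by
  obtain ⟨x₀, hx₀⟩ := ht
  ext x
  constructor
  · rintro ⟨hx, hmax⟩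
    by_contra hxt
    exact (hlt x ⟨hx, hxt⟩).not_ge (heq x₀ hx₀ ▸ hmax (hts hx₀))
  · intro hx
    refine ⟨hts hx, fun x' hx' => ?_⟩
    rw [Set.mem_ofPred_eq, heq x hx]
    by_cases hx't : x' ∈ t
    · exact (heq x' hx't).le
    · exact (hlt x' ⟨hx', hx't⟩).le

section Game

variable {p R RA RB v w a b : ℝ} {F G FA FB : Measure ℝ}

lemma measurableSet_le_add (p : ℝ) : MeasurableSet {z : ℝ × ℝ | z.2 ≤ z.1 + p} :=
  measurableSet_le measurable_snd (measurable_fst.add_const p)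

lemma payoffA_eq_lintegral [SFinite G] :
    payoffA p F G = (∫⁻ x, G (Set.Iic (x + p)) ∂F).toReal := by
  rw [payoffA, Measure.real, Measure.prod_apply (measurableSet_le_add p)]
  rfl

lemma payoffB_le_payoffA_neg [IsProbabilityMeasure FA] [IsProbabilityMeasure FB] :
    payoffB p FA FB ≤ payoffA (-p) FB FA := by
  have hswap : payoffA (-p) FB FA =
      (FA.prod FB).real (Prod.swap ⁻¹' {z | z.2 ≤ z.1 + -p}) := by
    rw [payoffA, ← Measure.prod_swap,
      map_measureReal_apply measurable_swap (measurableSet_le_add (-p))]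
  rw [payoffB, payoffA, ← probReal_compl_eq_one_sub (measurableSet_le_add p), hswap]
  refine measureReal_mono fun z hz => ?_
  simp only [Set.mem_compl_iff, Set.mem_ofPred_eq, not_le, Set.mem_preimage, Prod.snd_swap,
    Prod.fst_swap] at hz ⊢
  linarith

lemma payoffB_dirac_zero [IsProbabilityMeasure FA] :
    payoffB p FA (Measure.dirac 0) = FA.real (Set.Iio (-p)) := by
  have hpayoff : payoffA p FA (Measure.dirac 0) = FA.real (Set.Ici (-p)) := by
    rw [payoffA, Measure.prod_dirac,
      map_measureReal_apply measurable_prodMk_right (measurableSet_le_add p)]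
    congr 1
    ext x
    simp [← sub_nonneg]
  rw [payoffB, hpayoff, ← probReal_compl_eq_one_sub measurableSet_Ici, Set.compl_Ici]

lemma ae_nonneg_of_mem_strategies (hF : F ∈ strategies R) : ∀ᵐ x ∂F, 0 ≤ x := by
  filter_upwards [measure_eq_zero_iff_ae_notMem.1 hF.2.1] with x hx
  exact not_lt.1 hx

lemma payoffA_le_of_cdf_le (hR : 0 ≤ R) (ha : 0 ≤ a) (hb : 0 ≤ b) [SFinite G]
    (hF : F ∈ strategies R)
    (hcdf : ∀ x, 0 ≤ x → G (Set.Iic (x + p)) ≤ ENNReal.ofReal (a + b * x)) :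
    payoffA p F G ≤ a + b * R := by
  have := hF.1
  have hofReal (x : ℝ) (hx : 0 ≤ x) : ENNReal.ofReal (a + b * x) =
      ENNReal.ofReal a + ENNReal.ofReal b * ENNReal.ofReal x := by
    rw [← ENNReal.ofReal_mul hb, ← ENNReal.ofReal_add ha (by positivity)]
  rw [payoffA_eq_lintegral]
  refine ENNReal.toReal_le_of_le_ofReal (by positivity) ?_
  calc ∫⁻ x, G (Set.Iic (x + p)) ∂F
      ≤ ∫⁻ x, (ENNReal.ofReal a + ENNReal.ofReal b * ENNReal.ofReal x) ∂F := by
        refine lintegral_mono_ae ?_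
        filter_upwards [ae_nonneg_of_mem_strategies hF] with x hx
        exact (hcdf x hx).trans_eq (hofReal x hx)
    _ = ENNReal.ofReal a + ENNReal.ofReal b * ∫⁻ x, ENNReal.ofReal x ∂F := by
        rw [lintegral_add_left measurable_const, lintegral_const_mul _ (by fun_prop)]
        simp
    _ ≤ ENNReal.ofReal a + ENNReal.ofReal b * ENNReal.ofReal R := by
        gcongr
        exact hF.2.2
    _ = ENNReal.ofReal (a + b * R) := (hofReal R hR).symm

lemma isEquilibriumPayoffA_of_le_of_le (hFA : FA ∈ strategies RA) (hFB : FB ∈ strategies RB)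
    (hA : ∀ GA ∈ strategies RA, payoffA p GA FB ≤ v)
    (hB : ∀ GB ∈ strategies RB, payoffB p FA GB ≤ 1 - v) :
    IsEquilibriumPayoffA p RA RB v := by
  have hv : payoffA p FA FB = v := by
    have h := hB FB hFB
    rw [payoffB] at h
    exact le_antisymm (hA FA hFA) (by linarith)
  refine ⟨FA, FB, ⟨hFA, hFB, fun GA hGA => hv ▸ hA GA hGA, fun GB hGB => ?_⟩, hv⟩
  rw [payoffB.eq_1 p FA FB, hv]
  exact hB GB hGB

lemma IsEquilibriumPayoffA.unique (hv : IsEquilibriumPayoffA p RA RB v)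
    (hw : IsEquilibriumPayoffA p RA RB w) : v = w := by
  obtain ⟨FA, FB, ⟨hFA, hFB, hFA_best, hFB_best⟩, rfl⟩ := hv
  obtain ⟨GA, GB, ⟨hGA, hGB, hGA_best, hGB_best⟩, rfl⟩ := hw
  have h₁ := hFA_best GA hGA
  have h₂ := hFB_best GB hGB
  have h₃ := hGA_best FA hFA
  have h₄ := hGB_best FB hFB
  unfold payoffB at h₂ h₄
  linarith

lemma IsEquilibriumPayoffA.eqPayoffA_eq (hv : IsEquilibriumPayoffA p RA RB v) :
    eqPayoffA p RA RB = v := by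
  have : {v | IsEquilibriumPayoffA p RA RB v} = {v} :=
    Set.eq_singleton_iff_unique_mem.2 ⟨hv, fun _ hw => hw.unique hv⟩
  rw [eqPayoffA, this, csSup_singleton]

/-- `F` and `G` are optimal strategies for budgets `RF` and `RG` when `F` is favored by `p`, and
`w` is the value for the player using `G`. Ties are counted against both strategies, which makes
the notion symmetric in the two players and at least as strong as optimality under either
tie-breaking rule. -/
structure IsTieRobustSaddle (p RF RG w : ℝ) (F G : Measure ℝ) : Prop where
  left_mem : F ∈ strategies RF
  right_mem : G ∈ strategies RG
  payoff_right_le : ∀ F' ∈ strategies RF, payoffA p F' G ≤ 1 - w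
  payoff_left_le : ∀ G' ∈ strategies RG, payoffA (-p) G' F ≤ w

lemma IsTieRobustSaddle.symm (h : IsTieRobustSaddle p RA RB w F G) :
    IsTieRobustSaddle (-p) RB RA (1 - w) G F where
  left_mem := h.right_mem
  right_mem := h.left_mem
  payoff_right_le := by simpa using h.payoff_left_le
  payoff_left_le := by simpa using h.payoff_right_le

lemma IsTieRobustSaddle.isEquilibriumPayoffA (h : IsTieRobustSaddle p RA RB w F G) :
    IsEquilibriumPayoffA p RA RB (1 - w) := by
  refine isEquilibriumPayoffA_of_le_of_le h.left_mem h.right_mem h.payoff_right_le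
    fun GB hGB => ?_
  have := h.left_mem.1
  have := hGB.1
  rw [sub_sub_cancel]
  exact payoffB_le_payoffA_neg.trans (h.payoff_left_le GB hGB)

end Game

section Strategies

variable {β c L p R S z : ℝ} {F G : Measure ℝ}

lemma dirac_zero_mem_strategies (R : ℝ) : Measure.dirac 0 ∈ strategies R :=
  ⟨inferInstance, by simp, by simp⟩

lemma eq_dirac_zero_of_mem_strategies_zero (hF : F ∈ strategies 0) : F = Measure.dirac 0 := by
  have := hF.1
  have hmean : ∫⁻ x, ENNReal.ofReal x ∂F = 0 := by simpa using hF.2.2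
  have hzero : ∀ᵐ x ∂F, x ∈ ({0} : Set ℝ) := by
    filter_upwards [ae_nonneg_of_mem_strategies hF,
      (lintegral_eq_zero_iff (by fun_prop)).1 hmean] with x hx₀ hx
    exact le_antisymm (ENNReal.ofReal_eq_zero.1 hx) hx₀
  rw [← Measure.restrict_eq_self_of_ae_mem hzero, Measure.restrict_singleton,
    (prob_compl_eq_zero_iff (measurableSet_singleton 0)).1 hzero, one_smul]

lemma mixture_mem_strategies (hβ0 : 0 ≤ β) (hβ1 : β ≤ 1) (hR : 0 ≤ R) (hS : 0 ≤ S)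
    (hF : F ∈ strategies R) (hG : G ∈ strategies S) :
    ENNReal.ofReal (1 - β) • F + ENNReal.ofReal β • G ∈ strategies ((1 - β) * R + β * S) := by
  have hβ1' := sub_nonneg.2 hβ1
  have := hF.1
  have := hG.1
  refine ⟨⟨?_⟩, ?_, ?_⟩
  · simp [← ENNReal.ofReal_add hβ1' hβ0]
  · simp [hF.2.1, hG.2.1]
  · rw [lintegral_add_measure, lintegral_smul_measure, lintegral_smul_measure,
      ENNReal.ofReal_add (by positivity) (by positivity), ENNReal.ofReal_mul hβ1',
      ENNReal.ofReal_mul hβ0]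
    exact add_le_add (mul_le_mul_right hF.2.2 _) (mul_le_mul_right hG.2.2 _)

/-- The uniform distribution on `[c, c + L]`, as an affine image of the one on `[0, 1]` so that
`L = 0` gives the point mass at `c`. -/
noncomputable def uniformFrom (c L : ℝ) : Measure ℝ :=
  (volume.restrict (Set.Icc 0 1)).map fun t => c + L * t

lemma uniformFrom_apply {s : Set ℝ} (hs : MeasurableSet s) :
    uniformFrom c L s = volume ((fun t => c + L * t) ⁻¹' s ∩ Set.Icc 0 1) := by
  have haffine : Measurable fun t : ℝ => c + L * t := by fun_prop
  rw [uniformFrom, Measure.map_apply haffine hs, Measure.restrict_apply (haffine hs)]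

instance : IsProbabilityMeasure (uniformFrom c L) where
  measure_univ := by simp [uniformFrom_apply]

lemma uniformFrom_Iio (hL : 0 ≤ L) : uniformFrom c L (Set.Iio c) = 0 := by
  rw [uniformFrom_apply measurableSet_Iio]
  refine measure_mono_null (t := ∅) (fun t ⟨ht, ht0, _⟩ => ?_) measure_empty
  have := mul_nonneg hL ht0
  exact absurd ht (by simpa using this)

lemma uniformFrom_Iic_le (hL : 0 < L) :
    uniformFrom c L (Set.Iic z) ≤ ENNReal.ofReal ((z - c) / L) := by
  have hsub : (fun t : ℝ => c + L * t) ⁻¹' Set.Iic z ∩ Set.Icc 0 1 ⊆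
      Set.Icc 0 ((z - c) / L) := by
    rintro t ⟨ht, ht0, -⟩
    exact ⟨ht0, (le_div_iff₀' hL).2 (le_sub_iff_add_le'.2 ht)⟩
  rw [uniformFrom_apply measurableSet_Iic]
  simpa using measure_mono (μ := volume) hsub

lemma lintegral_uniformFrom (hc : 0 ≤ c) (hL : 0 ≤ L) :
    ∫⁻ x, ENNReal.ofReal x ∂(uniformFrom c L) = ENNReal.ofReal (c + L / 2) := by
  rw [uniformFrom, lintegral_map (by fun_prop) (by fun_prop), ← ofReal_integral_eq_lintegral_ofReal
    (by fun_prop : Continuous fun t : ℝ => c + L * t).continuousOn.integrableOn_Icc]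
  · rw [integral_Icc_eq_integral_Ioc, ← intervalIntegral.integral_of_le zero_le_one,
      intervalIntegral.integral_add (by simp)
        ((by fun_prop : Continuous fun t : ℝ => L * t).intervalIntegrable 0 1),
      intervalIntegral.integral_const_mul, integral_id]
    simp [div_eq_mul_inv]
  · filter_upwards [ae_restrict_mem measurableSet_Icc] with t ht
    exact add_nonneg hc (mul_nonneg hL ht.1)

lemma uniformFrom_mem_strategies (hc : 0 ≤ c) (hL : 0 ≤ L) :
    uniformFrom c L ∈ strategies (c + L / 2) :=
  ⟨inferInstance, measure_mono_null (Set.Iio_subset_Iio hc) (uniformFrom_Iio hL),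
    (lintegral_uniformFrom hc hL).le⟩

/-- The equilibrium strategies: bid `0` with probability `1 - β`, and uniformly on `[c, c + L]`
otherwise. -/
noncomputable def atomUniform (β c L : ℝ) : Measure ℝ :=
  ENNReal.ofReal (1 - β) • Measure.dirac 0 + ENNReal.ofReal β • uniformFrom c L

lemma atomUniform_mem_strategies (hβ0 : 0 ≤ β) (hβ1 : β ≤ 1) (hc : 0 ≤ c) (hL : 0 ≤ L)
    (hR : β * (c + L / 2) = R) : atomUniform β c L ∈ strategies R := by
  rw [← hR]
  simpa [atomUniform] using mixture_mem_strategies hβ0 hβ1 le_rfl (by positivity)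
    (dirac_zero_mem_strategies 0) (uniformFrom_mem_strategies hc hL)

lemma atomUniform_Iic_le (hβ0 : 0 ≤ β) (hβ1 : β ≤ 1) (hL : 0 < L) (hz : c ≤ z) :
    atomUniform β c L (Set.Iic z) ≤ ENNReal.ofReal (1 - β + β * ((z - c) / L)) := by
  have : 0 ≤ (z - c) / L := div_nonneg (sub_nonneg.2 hz) hL.le
  rw [ENNReal.ofReal_add (sub_nonneg.2 hβ1) (by positivity), ENNReal.ofReal_mul hβ0]
  exact add_le_add (mul_le_of_le_one_right' prob_le_one)
    (mul_le_mul_right (uniformFrom_Iic_le hL) _)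

lemma payoffA_atomUniform_le (hβ0 : 0 ≤ β) (hβ1 : β ≤ 1) (hL : 0 < L) (hR : 0 ≤ R)
    (hc : c = 0 ∨ c = p) (hp : 0 ≤ 1 - β + β * ((p - c) / L)) (hF : F ∈ strategies R) :
    payoffA p F (atomUniform β c L) ≤ 1 - β + β * ((R + p - c) / L) := by
  have : SFinite (atomUniform β c L) := by unfold atomUniform; infer_instance
  have hsplit (x : ℝ) : 1 - β + β * ((x + p - c) / L) =
      1 - β + β * ((p - c) / L) + β / L * x := by ring
  rw [hsplit]
  refine payoffA_le_of_cdf_le hR hp (by positivity) hF fun x hx => ?_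
  rcases le_or_gt c (x + p) with hz | hz
  · rw [← hsplit]
    exact atomUniform_Iic_le hβ0 hβ1 hL hz
  · obtain rfl : c = 0 := hc.resolve_right (by linarith)
    have hmem := atomUniform_mem_strategies hβ0 hβ1 le_rfl hL.le rfl
    rw [measure_mono_null (Set.Iic_subset_Iio.2 hz) hmem.2.1]
    exact zero_le

end Strategies

section Value

variable {L p p' q Rf Ru RA RB : ℝ}

/-- The length of the interval on which the player favored by `p` and holding budget `R` makes its
positive bids in the equilibrium where the opponent sometimes gives up; it is the positive root of
`ℓ ^ 2 = 2 * R * (ℓ + p)`. The expressions `f_A` and `f_B * (f_B + g_B)` are bid lengths. -/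
noncomputable def bidLength (R p : ℝ) : ℝ := R + √(R * (R + 2 * p))

lemma bidLength_sq (hR : 0 ≤ Rf) (hp : 0 ≤ p) :
    bidLength Rf p ^ 2 = 2 * Rf * (bidLength Rf p + p) := by
  rw [bidLength]
  linear_combination Real.sq_sqrt (by positivity : 0 ≤ Rf * (Rf + 2 * p))

lemma two_mul_le_bidLength (hR : 0 ≤ Rf) (hp : 0 ≤ p) : 2 * Rf ≤ bidLength Rf p := by
  have : Rf ≤ √(Rf * (Rf + 2 * p)) := Real.le_sqrt_of_sq_le (by nlinarith [mul_nonneg hR hp])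
  rw [bidLength]
  linarith

lemma bidLength_zero_right (hR : 0 ≤ Rf) : bidLength Rf 0 = 2 * Rf := by
  rw [bidLength, mul_zero, add_zero, Real.sqrt_mul_self hR, two_mul]

lemma bidLength_nonneg (hR : 0 ≤ Rf) : 0 ≤ bidLength Rf p :=
  add_nonneg hR (Real.sqrt_nonneg _)

lemma bidLength_pos (hR : 0 < Rf) : 0 < bidLength Rf p :=
  add_pos_of_pos_of_nonneg hR (Real.sqrt_nonneg _)

lemma bidLength_lt_bidLength (hR : 0 < Rf) (hp : 0 ≤ p) (h : p < p') :
    bidLength Rf p < bidLength Rf p' := by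
  unfold bidLength
  gcongr

lemma lt_sq_of_bidLength_lt (h : bidLength Rf p < L) :
    2 * Rf * (L + p) < L ^ 2 := by
  have hsqrt : √(Rf * (Rf + 2 * p)) < L - Rf := by
    rw [bidLength] at h
    linarith
  have := Real.lt_sq_of_sqrt_lt hsqrt
  linarith

/-- The equilibrium payoff of the player with budget `Ru` against an opponent with budget `Rf` who
is favored by `p ≥ 0`. -/
noncomputable def underdogPayoff (p Rf Ru : ℝ) : ℝ :=
  if Ru ≤ p + bidLength Rf p / 2 then Ru / (p + bidLength Rf p) else 1 - Rf / (2 * (Ru - p))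

-- The hypothesis `htight` is complementary slackness: the underdog gives up with positive
-- probability only if the affine bound on its payoff vanishes at the bid `0`.
lemma isTieRobustSaddle_atomUniform (hp : 0 ≤ p) (hRf : 0 ≤ Rf) (hRu : 0 ≤ Ru) (hL : 0 < L)
    (hsq : 2 * Rf * (L + p) ≤ L ^ 2) (hRuL : Ru ≤ p + L / 2)
    (htight : Ru = p + L / 2 ∨ L ^ 2 = 2 * Rf * (L + p)) :
    IsTieRobustSaddle p Rf Ru (Ru * (L - Rf) / (L * (p + L / 2)))
      (atomUniform (2 * Rf / L) 0 L) (atomUniform (Ru / (p + L / 2)) p L) := by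
  have hβ : 2 * Rf / L ≤ 1 := (div_le_one hL).2 (by nlinarith [mul_nonneg hRf hp])
  have hγ : Ru / (p + L / 2) ≤ 1 := (div_le_one (by positivity)).2 hRuL
  have hslack : 1 - 2 * Rf / L + 2 * Rf / L * ((-p - 0) / L) =
      (L ^ 2 - 2 * Rf * (L + p)) / L ^ 2 := by
    field_simp
    ring
  refine ⟨atomUniform_mem_strategies (by positivity) hβ le_rfl hL.le (by field_simp; ring),
    atomUniform_mem_strategies (by positivity) hγ hp hL.le (by field_simp),
    fun F' hF' => ?_, fun G' hG' => ?_⟩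
  · refine (payoffA_atomUniform_le (by positivity) hγ hL hRf (.inr rfl) ?_ hF').trans_eq ?_
    · simpa using hγ
    · field_simp
      ring
  · refine (payoffA_atomUniform_le (by positivity) hβ hL hRu (.inl rfl) ?_ hG').trans_eq ?_
    · rw [hslack]
      exact div_nonneg (sub_nonneg.2 hsq) (sq_nonneg L)
    · rcases htight with rfl | htight
      · field_simp
        ring
      · field_simp
        linear_combination (L + 2 * p - 2 * Ru) * htight

lemma exists_isTieRobustSaddle_underdogPayoff (hp : 0 ≤ p) (hRf : 0 ≤ Rf) (hRu : 0 ≤ Ru)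
    (hpos : 0 < Rf ∨ p < Ru) :
    ∃ F G, IsTieRobustSaddle p Rf Ru (underdogPayoff p Rf Ru) F G := by
  have hsq := bidLength_sq hRf hp
  have hle := two_mul_le_bidLength hRf hp
  rcases le_or_gt Ru (p + bidLength Rf p / 2) with h | h
  · have hℓ : 0 < bidLength Rf p := by
      rcases hpos with hpos | hpos <;> linarith
    have hvalue : underdogPayoff p Rf Ru =
        Ru * (bidLength Rf p - Rf) / (bidLength Rf p * (p + bidLength Rf p / 2)) := by
      rw [underdogPayoff, if_pos h]
      field_simp
      linear_combination -Ru * hsq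
    rw [hvalue]
    exact ⟨_, _, isTieRobustSaddle_atomUniform hp hRf hRu hℓ hsq.ge h (.inr hsq)⟩
  · have hL : bidLength Rf p < 2 * (Ru - p) := by linarith
    have hd : 0 < Ru - p := by linarith
    have hvalue : underdogPayoff p Rf Ru =
        Ru * (2 * (Ru - p) - Rf) / (2 * (Ru - p) * (p + 2 * (Ru - p) / 2)) := by
      rw [underdogPayoff, if_neg h.not_ge]
      field_simp
      ring
    rw [hvalue]
    exact ⟨_, _, isTieRobustSaddle_atomUniform hp hRf hRu (by linarith)
      (lt_sq_of_bidLength_lt hL).le (by linarith) (.inl (by ring))⟩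

lemma isEquilibriumPayoffA_of_nonneg (hp : 0 ≤ p) (hRA : 0 < RA) (hRB : 0 ≤ RB) :
    IsEquilibriumPayoffA p RA RB (1 - underdogPayoff p RA RB) := by
  obtain ⟨F, G, h⟩ := exists_isTieRobustSaddle_underdogPayoff hp hRA.le hRB (.inl hRA)
  exact h.isEquilibriumPayoffA

lemma dirac_zero_Iic_le {x : ℝ} (hq : 0 < q) :
    Measure.dirac 0 (Set.Iic (x - q)) ≤ ENNReal.ofReal (x / q) := by
  rcases lt_or_ge x q with h | h
  · simp [h]
  · exact prob_le_one.trans (ENNReal.one_le_ofReal.2 ((one_le_div hq).2 h))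

-- The tie-breaking rule matters here: matching the favoritism exactly wins against the bid `0`.
lemma isEquilibriumPayoffA_neg_zero (hq : 0 < q) (hRA : 0 ≤ RA) (h : RA ≤ q) :
    IsEquilibriumPayoffA (-q) RA 0 (RA / q) := by
  have hdiv : RA / q ≤ 1 := (div_le_one hq).2 h
  have hFA : atomUniform (RA / q) q 0 ∈ strategies RA :=
    atomUniform_mem_strategies (by positivity) hdiv hq.le le_rfl (by field_simp; ring)
  have := hFA.1
  refine isEquilibriumPayoffA_of_le_of_le hFA (dirac_zero_mem_strategies 0)
    (fun GA hGA => ?_) (fun GB hGB => ?_)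
  · refine (payoffA_le_of_cdf_le (a := 0) (b := 1 / q) hRA le_rfl (by positivity) hGA
      fun x _ => ?_).trans_eq (by ring)
    simpa [← sub_eq_add_neg, inv_mul_eq_div] using dirac_zero_Iic_le hq
  · have hatom : atomUniform (RA / q) q 0 (Set.Iio q) = ENNReal.ofReal (1 - RA / q) := by
      simp [atomUniform, uniformFrom_Iio, hq]
    rw [eq_dirac_zero_of_mem_strategies_zero hGB, payoffB_dirac_zero, neg_neg, Measure.real, hatom,
      ENNReal.toReal_ofReal (sub_nonneg.2 hdiv)]

lemma isEquilibriumPayoffA_neg (hq : 0 < q) (hRA : 0 < RA) (hRB : 0 ≤ RB) :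
    IsEquilibriumPayoffA (-q) RA RB (underdogPayoff q RB RA) := by
  by_cases hpos : 0 < RB ∨ q < RA
  · obtain ⟨F, G, h⟩ := exists_isTieRobustSaddle_underdogPayoff hq.le hRB hRA.le hpos
    simpa using h.symm.isEquilibriumPayoffA
  · rw [not_or, not_lt, not_lt] at hpos
    obtain rfl : RB = 0 := hpos.1.antisymm hRB
    have hℓ : bidLength 0 q = 0 := by simp [bidLength]
    rw [underdogPayoff, hℓ, if_pos (by simpa using hpos.2), add_zero]
    exact isEquilibriumPayoffA_neg_zero hq hRA.le hpos.2

lemma existsUnique_isEquilibriumPayoffA (p : ℝ) (hRA : 0 < RA) (hRB : 0 ≤ RB) :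
    ∃! v, IsEquilibriumPayoffA p RA RB v := by
  suffices ∃ v, IsEquilibriumPayoffA p RA RB v by
    obtain ⟨v, hv⟩ := this
    exact ⟨v, hv, fun _ hw => hw.unique hv⟩
  rcases le_or_gt 0 p with hp | hp
  · exact ⟨_, isEquilibriumPayoffA_of_nonneg hp hRA hRB⟩
  · exact ⟨_, by simpa using isEquilibriumPayoffA_neg (neg_pos.2 hp) hRA hRB⟩

end Value

section Response

variable {c d p q R L L' y : ℝ}

/-- The payoff of a player who keeps the real-time budget `c * (y + p)` against the favoritism `p`,
expressed through the bid length `L` of a favored opponent with budget `R`. For the responses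
`p_B ≤ p_A` of the Stackelberg game, `y = M_B / c_B - p_A` does not depend on `p_B`. -/
noncomputable def weakPayoff (c R y L : ℝ) : ℝ := c * (1 - 2 * R / L + 2 * R * y / L ^ 2)

/-- The payoff of the response `p̂_B`, where `y = M_B / c_B - p_A`. -/
noncomputable def hatPayoff (c R y : ℝ) : ℝ := 1 - R * (2 - c) / (2 * y)

/-- The polynomial in `y` whose sign is that of `hatPayoff c R y - weakPayoff c R y L` for
`0 < y`. -/
noncomputable def payoffGap (c R L y : ℝ) : ℝ :=
  2 * (1 - c) * (y - R) - c * R * (2 * y / L - 1) ^ 2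

lemma div_add_bidLength_eq_weakPayoff (hR : 0 < R) (hp : 0 ≤ p) :
    c * (y + p) / (p + bidLength R p) = weakPayoff c R y (bidLength R p) := by
  have hℓ : 0 < bidLength R p := bidLength_pos hR
  have hsq := bidLength_sq hR.le hp
  rw [weakPayoff]
  field_simp
  linear_combination c * (y - bidLength R p) * hsq

lemma weakPayoff_lt_weakPayoff (hc : 0 < c) (hR : 0 < R) (hL : 0 < L) (hLL' : L < L')
    (hy : 2 * y ≤ L) : weakPayoff c R y L < weakPayoff c R y L' := by
  have hL' : 0 < L' := hL.trans hLL'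
  have hdiff : weakPayoff c R y L' - weakPayoff c R y L =
      2 * R * c * (L' - L) * (L * L' - y * (L + L')) / (L ^ 2 * L' ^ 2) := by
    unfold weakPayoff
    field_simp
    ring
  have hfactor : 0 < L * L' - y * (L + L') := by nlinarith
  have := sub_pos.2 hLL'
  exact sub_pos.1 (hdiff ▸ by positivity)

lemma hatPayoff_sub_weakPayoff (hy : y ≠ 0) (hL : L ≠ 0) :
    hatPayoff c R y - weakPayoff c R y L = payoffGap c R L y / (2 * y) := by
  unfold hatPayoff weakPayoff payoffGap
  field_simp
  ring

lemma payoffGap_strictMonoOn (hc0 : 0 < c) (hc1 : c < 1) (hR : 0 < R) (hL : 0 < L) :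
    StrictMonoOn (payoffGap c R L) (Set.Iic (L / 2)) := by
  intro y _ y' hy' hyy'
  have hsquare : (2 * y' / L - 1) ^ 2 ≤ (2 * y / L - 1) ^ 2 := by
    have hle : 2 * y' / L ≤ 1 := (div_le_one hL).2 (by linarith [Set.mem_Iic.1 hy'])
    have hlt : 2 * y / L ≤ 2 * y' / L := by gcongr
    nlinarith
  have hlinear : 2 * (1 - c) * (y - R) < 2 * (1 - c) * (y' - R) := by
    have := sub_pos.2 hc1
    gcongr
  have := mul_le_mul_of_nonneg_left hsquare (mul_pos hc0 hR).le
  unfold payoffGap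
  linarith

lemma existsUnique_payoffGap_eq_zero (hc0 : 0 < c) (hc1 : c < 1) (hR : 0 < R) (hL : 2 * R < L) :
    ∃! y, y ∈ Set.Ioo R (L / 2) ∧ payoffGap c R L y = 0 := by
  have hL0 : 0 < L := by linarith
  have hleft : payoffGap c R L R < 0 := by
    have : 2 * R / L - 1 ≠ 0 := (sub_neg.2 ((div_lt_one hL0).2 hL)).ne
    rw [payoffGap, sub_self, mul_zero, zero_sub]
    exact neg_neg_of_pos (by positivity)
  have hright : 0 < payoffGap c R L (L / 2) := by
    have hone : 2 * (L / 2) / L = 1 := by field_simp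
    rw [payoffGap, hone]
    nlinarith
  have hcont : ContinuousOn (payoffGap c R L) (Set.Icc R (L / 2)) := by
    unfold payoffGap
    fun_prop
  obtain ⟨y, hy, hzero⟩ := intermediate_value_Ioo (by linarith) hcont ⟨hleft, hright⟩
  refine ⟨y, ⟨hy, hzero⟩, fun y' ⟨hy', hzero'⟩ => ?_⟩
  exact (payoffGap_strictMonoOn hc0 hc1 hR hL0).injOn hy'.2.le hy.2.le (hzero'.trans hzero.symm)

lemma mul_sub_one_sq_lt {w z : ℝ} (hc0 : 0 < c) (hc1 : c < 1) (hw : 1 < w) (hwz : w ≤ z)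
    (h : c * w ^ 2 + (1 - 2 * c) * w ≤ 2 * (1 - c) * z) :
    c * (w - 1) ^ 2 < 2 * (1 - c) * (z - 1) := by
  rcases lt_or_ge (2 - c) w with hlt | hge
  · linarith
  · have hz : 0 < (1 - c) * (z - 1) := mul_pos (sub_pos.2 hc1) (by linarith)
    calc c * (w - 1) ^ 2 = c * ((w - 1) * (w - 1)) := by ring
      _ ≤ c * ((1 - c) * (z - 1)) := by
        have : 0 ≤ w - 1 := by linarith
        have : w - 1 ≤ 1 - c := by linarith
        gcongr
      _ < 2 * ((1 - c) * (z - 1)) := by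
        gcongr
        linarith
      _ = 2 * (1 - c) * (z - 1) := by ring

lemma payoffGap_pos (hc0 : 0 < c) (hc1 : c < 1) (hR : 0 < R) (hp : 0 ≤ p)
    (hy : bidLength R p < 2 * y) (hweak : c * (y + p) ≤ p + bidLength R p / 2) :
    0 < payoffGap c R (bidLength R p) y := by
  have hℓ : 0 < bidLength R p := bidLength_pos hR
  have hsq := bidLength_sq hR.le hp
  have hle := two_mul_le_bidLength hR.le hp
  have hy0 : 0 < y := by linarith
  set ℓ := bidLength R p
  have hgap : payoffGap c R ℓ y =
      R * (2 * (1 - c) * (y / R - 1) - c * (2 * y / ℓ - 1) ^ 2) := by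
    rw [payoffGap]
    field_simp
  have hwz : 2 * y / ℓ ≤ y / R := by
    rw [div_le_div_iff₀ hℓ hR]
    nlinarith
  have hquad : c * (2 * y / ℓ) ^ 2 + (1 - 2 * c) * (2 * y / ℓ) ≤ 2 * (1 - c) * (y / R) := by
    have hscaled : 2 * (1 - c) * (y / R) - (c * (2 * y / ℓ) ^ 2 + (1 - 2 * c) * (2 * y / ℓ)) =
        4 * y / ℓ ^ 2 * (p + ℓ / 2 - c * (y + p)) := by
      field_simp
      linear_combination 4 * (1 - c) * hsq
    have := sub_nonneg.2 hweak
    exact sub_nonneg.1 (hscaled ▸ by positivity)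
  rw [hgap]
  exact mul_pos hR (sub_pos.2 (mul_sub_one_sq_lt hc0 hc1 ((one_lt_div hℓ).2 hy) hwz hquad))

lemma underdogPayoff_eq_weakPayoff (hc1 : c ≤ 1) (hR : 0 < R) (hp : 0 ≤ p)
    (hyp : 0 ≤ y + p) (hy : 2 * y ≤ bidLength R p) :
    underdogPayoff p R (c * (y + p)) = weakPayoff c R y (bidLength R p) := by
  have hweak : c * (y + p) ≤ p + bidLength R p / 2 :=
    (mul_le_of_le_one_left hyp hc1).trans (by linarith)
  rw [underdogPayoff, if_pos hweak, div_add_bidLength_eq_weakPayoff hR hp]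

lemma underdogPayoff_lt_hatPayoff (hc0 : 0 < c) (hc1 : c < 1) (hR : 0 < R) (hp : 0 ≤ p)
    (hy : bidLength R p < 2 * y) : underdogPayoff p R (c * (y + p)) < hatPayoff c R y := by
  have hℓ : 0 < bidLength R p := bidLength_pos hR
  have hy0 : 0 < y := by linarith
  rcases le_or_gt (c * (y + p)) (p + bidLength R p / 2) with hweak | hstrong
  · rw [underdogPayoff, if_pos hweak, div_add_bidLength_eq_weakPayoff hR hp, ← sub_pos,
      hatPayoff_sub_weakPayoff hy0.ne' hℓ.ne']
    exact div_pos (payoffGap_pos hc0 hc1 hR hp hy hweak) (by positivity)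
  · have hs : 0 < c * (y + p) - p := by linarith
    have hlt : (2 - c) * (c * (y + p) - p) < y := by
      have : c * (y + p) - p ≤ c * y := by nlinarith
      nlinarith [sq_pos_of_pos (sub_pos.2 hc1)]
    rw [underdogPayoff, if_neg hstrong.not_ge, hatPayoff, sub_lt_sub_iff_left,
      div_lt_div_iff₀ (by positivity) (by positivity)]
    nlinarith

lemma two_sub_mul_add_bidLength_le (hc : 0 < c) (hd : 0 ≤ d) (hq : 0 < q) :
    (2 - c) * (q + bidLength (c * d) q) ≤ 2 * (q + d) ∧
      ((2 - c) * (q + bidLength (c * d) q) = 2 * (q + d) →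
        (2 - c) * q = 2 * (1 - c) * (q + d)) := by
  have hsq := bidLength_sq (mul_nonneg hc.le hd) hq.le
  have hℓ := two_mul_le_bidLength (mul_nonneg hc.le hd) hq.le
  set S := q + bidLength (c * d) q with hS
  have hS0 : 0 < S := by nlinarith
  have hsquare : c * S * (2 * (q + d) - (2 - c) * S) = (S - q - c * S) ^ 2 := by
    rw [hS]
    linear_combination -hsq
  constructor
  · have := (mul_nonneg_iff_of_pos_left (by positivity)).1 (hsquare ▸ sq_nonneg _)
    linarith
  · intro h
    rw [h, sub_self, mul_zero, eq_comm, sq_eq_zero_iff] at hsquare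
    linear_combination (1 - c) * h - (2 - c) * hsquare

lemma one_sub_underdogPayoff_le_hatPayoff (hc0 : 0 < c) (hR : 0 < R) (hd : 0 ≤ d)
    (hq : 0 < q) (h : R ≤ q + bidLength (c * d) q / 2) :
    1 - underdogPayoff q (c * d) R ≤ hatPayoff c R (q + d) ∧
      (1 - underdogPayoff q (c * d) R = hatPayoff c R (q + d) →
        (2 - c) * q = 2 * (1 - c) * (q + d)) := by
  obtain ⟨hle, heq⟩ := two_sub_mul_add_bidLength_le hc0 hd hq
  have hS : 0 < q + bidLength (c * d) q :=
    add_pos_of_pos_of_nonneg hq (bidLength_nonneg (mul_nonneg hc0.le hd))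
  rw [underdogPayoff, if_pos h, hatPayoff, sub_le_sub_iff_left, sub_right_inj,
    div_le_div_iff₀ (by positivity) hS, div_eq_div_iff hS.ne' (by positivity), mul_assoc,
    mul_le_mul_iff_right₀ hR, mul_right_inj' hR.ne']
  exact ⟨hle, fun h => heq h.symm⟩

lemma one_sub_underdogPayoff_of_lt (h : q + bidLength (c * d) q / 2 < R) :
    1 - underdogPayoff q (c * d) R = c * d / (2 * (R - q)) := by
  rw [underdogPayoff, if_neg h.not_ge, sub_sub_cancel]

lemma one_sub_underdogPayoff_lt_hatPayoff (hc0 : 0 < c) (hd : 0 ≤ d)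
    (hq : 0 < q) (h : q + bidLength (c * d) q / 2 < R) (hRy : R < q + d) :
    1 - underdogPayoff q (c * d) R < hatPayoff c R (q + d) := by
  have hlt : bidLength (c * d) q < 2 * (R - q) := by linarith
  have hsq := lt_sq_of_bidLength_lt hlt
  have hρ : 0 < R - q := by linarith [bidLength_nonneg (p := q) (mul_nonneg hc0.le hd)]
  have hfactor : 0 < (2 - c) * (R - q) - c * (q + d) := by
    refine (mul_pos_iff_of_pos_left hρ).1 ?_
    nlinarith [mul_pos hc0 (mul_pos (sub_pos.2 hRy) (hq.trans (sub_pos.1 hρ)))]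
  have hdiff : hatPayoff c R (q + d) - c * d / (2 * (R - q)) =
      (q + d - R) * ((2 - c) * (R - q) - c * (q + d)) / (2 * (q + d) * (R - q)) := by
    rw [hatPayoff]
    field_simp
    ring
  have := sub_pos.2 hRy
  rw [one_sub_underdogPayoff_of_lt h]
  exact sub_pos.1 (hdiff ▸ by positivity)

lemma one_sub_underdogPayoff_le_weakPayoff (hc : 0 ≤ c) (hR : 0 < R) (hd : 0 ≤ d) (hq : 0 < q)
    (h : q + bidLength (c * d) q / 2 < R) (hyR : q + d ≤ R) :
    1 - underdogPayoff q (c * d) R ≤ weakPayoff c R (q + d) (2 * R) := by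
  have hρ : 0 < R - q := by linarith [bidLength_nonneg (p := q) (mul_nonneg hc hd)]
  have hvalue : weakPayoff c R (q + d) (2 * R) = c * (q + d) / (2 * R) := by
    rw [weakPayoff]
    field_simp
    ring
  rw [one_sub_underdogPayoff_of_lt h, hvalue, div_le_div_iff₀ (by positivity) (by positivity)]
  nlinarith [mul_nonneg hc (mul_nonneg hq.le (sub_nonneg.2 hyR))]

end Response

section Stackelberg

variable {RA MB cB pA pB m h : ℝ}

lemma uB_of_le (hRA : 0 < RA) (h : pB ≤ pA) (hRB : 0 ≤ MB - cB * pB) :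
    uB RA MB cB pA pB = underdogPayoff (pA - pB) RA (MB - cB * pB) := by
  rw [uB, (isEquilibriumPayoffA_of_nonneg (sub_nonneg.2 h) hRA hRB).eqPayoffA_eq, sub_sub_cancel]

lemma uB_of_lt (hRA : 0 < RA) (h : pA < pB) (hRB : 0 ≤ MB - cB * pB) :
    uB RA MB cB pA pB = 1 - underdogPayoff (pB - pA) (MB - cB * pB) RA := by
  have := isEquilibriumPayoffA_neg (sub_pos.2 h) hRA hRB
  rw [neg_sub] at this
  rw [uB, this.eqPayoffA_eq]

lemma uB_eq_weakPayoff (hcB0 : 0 ≤ cB) (hcB1 : cB ≤ 1) (hRA : 0 < RA) (h : pB ≤ pA) (hm : pB ≤ m)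
    (hy : 2 * (m - pA) ≤ bidLength RA (pA - pB)) :
    uB RA (cB * m) cB pA pB = weakPayoff cB RA (m - pA) (bidLength RA (pA - pB)) := by
  have hRB : cB * m - cB * pB = cB * (m - pA + (pA - pB)) := by ring
  have hnet : 0 ≤ m - pA + (pA - pB) := by linarith
  rw [uB_of_le hRA h (hRB ▸ mul_nonneg hcB0 hnet), hRB,
    underdogPayoff_eq_weakPayoff hcB1 hRA (sub_nonneg.2 h) hnet hy]

lemma uB_lt_hatPayoff (hcB0 : 0 < cB) (hcB1 : cB < 1) (hRA : 0 < RA) (h : pB ≤ pA)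
    (hy : bidLength RA (pA - pB) < 2 * (m - pA)) :
    uB RA (cB * m) cB pA pB < hatPayoff cB RA (m - pA) := by
  have hRB : cB * m - cB * pB = cB * (m - pA + (pA - pB)) := by ring
  have hnet : 0 ≤ m - pA + (pA - pB) := by
    linarith [bidLength_nonneg (p := pA - pB) hRA.le]
  rw [uB_of_le hRA h (hRB ▸ mul_nonneg hcB0.le hnet), hRB]
  exact underdogPayoff_lt_hatPayoff hcB0 hcB1 hRA (sub_nonneg.2 h) hy

lemma uB_lt_uB_zero (hcB0 : 0 < cB) (hcB1 : cB < 1) (hRA : 0 < RA) (hpB : 0 < pB) (h : pB ≤ pA)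
    (hm : pB ≤ m) (hy : 2 * (m - pA) ≤ bidLength RA (pA - pB)) :
    uB RA (cB * m) cB pA pB < uB RA (cB * m) cB pA 0 := by
  have hlt : bidLength RA (pA - pB) < bidLength RA (pA - 0) :=
    bidLength_lt_bidLength hRA (sub_nonneg.2 h) (by linarith)
  rw [uB_eq_weakPayoff hcB0.le hcB1.le hRA h hm hy,
    uB_eq_weakPayoff hcB0.le hcB1.le hRA (by linarith) (by linarith) (hy.trans hlt.le)]
  exact weakPayoff_lt_weakPayoff hcB0 hRA (bidLength_pos hRA) hlt hy

lemma pHatB_mul_eq (hcB0 : cB ≠ 0) (hcB2 : 2 - cB ≠ 0) :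
    pHatB (cB * m) cB pA = pA + 2 * (1 - cB) * (m - pA) / (2 - cB) := by
  rw [pHatB]
  field_simp
  ring

lemma eq_pHatB_of_mul_eq (hcB0 : cB ≠ 0) (hcB2 : 2 - cB ≠ 0)
    (h : (2 - cB) * (pB - pA) = 2 * (1 - cB) * (m - pA)) : pB = pHatB (cB * m) cB pA := by
  rw [pHatB_mul_eq hcB0 hcB2, ← h, mul_div_cancel_left₀ _ hcB2, add_sub_cancel]

lemma pHatB_mem_Ioo (hcB0 : 0 < cB) (hcB1 : cB < 1) (hm : pA < m) :
    pHatB (cB * m) cB pA ∈ Set.Ioo pA m := by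
  have := sub_pos.2 hm
  have := sub_pos.2 hcB1
  have hden : 0 < 2 - cB := by linarith
  have hlt : 2 * (1 - cB) * (m - pA) / (2 - cB) < m - pA := by
    rw [div_lt_iff₀ hden]
    nlinarith
  rw [pHatB_mul_eq hcB0.ne' (by linarith)]
  exact ⟨lt_add_of_pos_right _ (by positivity), by linarith⟩

lemma uB_lt_uB_zero_or_le_hatPayoff_of_lt (hcB0 : 0 < cB) (hcB1 : cB < 1) (hRA : 0 < RA)
    (hpA : 0 < pA) (h : pA < pB) (hm : pB ≤ m) :
    uB RA (cB * m) cB pA pB < uB RA (cB * m) cB pA 0 ∨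
      uB RA (cB * m) cB pA pB ≤ hatPayoff cB RA (m - pA) ∧
        (uB RA (cB * m) cB pA pB = hatPayoff cB RA (m - pA) → pB = pHatB (cB * m) cB pA) := by
  have hq := sub_pos.2 h
  have hd := sub_nonneg.2 hm
  have hy : m - pA = pB - pA + (m - pB) := by ring
  have hu : uB RA (cB * m) cB pA pB = 1 - underdogPayoff (pB - pA) (cB * (m - pB)) RA := by
    rw [uB_of_lt hRA h (by nlinarith), mul_sub]
  have hRAℓ : 2 * RA < bidLength RA (pA - 0) := by
    rw [← bidLength_zero_right hRA.le]
    exact bidLength_lt_bidLength hRA le_rfl (by linarith)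
  rcases le_or_gt RA (pB - pA + bidLength (cB * (m - pB)) (pB - pA) / 2) with hweak | hstrong
  · obtain ⟨hle, heq⟩ := one_sub_underdogPayoff_le_hatPayoff hcB0 hRA hd hq hweak
    rw [hu, hy]
    exact .inr ⟨hle, fun h' => eq_pHatB_of_mul_eq hcB0.ne' (by linarith) (hy ▸ heq h')⟩
  rcases lt_or_ge RA (m - pA) with hRy | hyR
  · have hlt := one_sub_underdogPayoff_lt_hatPayoff hcB0 hd hq hstrong (hy ▸ hRy)
    rw [hu, hy]
    exact .inr ⟨hlt.le, fun h' => absurd h' hlt.ne⟩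
  · left
    rw [hu, uB_eq_weakPayoff hcB0.le hcB1.le hRA hpA.le (by linarith) (by linarith), hy]
    exact (one_sub_underdogPayoff_le_weakPayoff hcB0.le hRA hd hq hstrong (by linarith)).trans_lt
      (weakPayoff_lt_weakPayoff hcB0 hRA (by positivity) hRAℓ (by linarith))

lemma uB_lt_uB_zero_or_le_hatPayoff (hcB0 : 0 < cB) (hcB1 : cB < 1) (hRA : 0 < RA)
    (hpA : 0 < pA) (hpB : 0 < pB) (hm : pB ≤ m) :
    uB RA (cB * m) cB pA pB < uB RA (cB * m) cB pA 0 ∨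
      pA < m ∧ uB RA (cB * m) cB pA pB ≤ hatPayoff cB RA (m - pA) ∧
        (uB RA (cB * m) cB pA pB = hatPayoff cB RA (m - pA) → pB = pHatB (cB * m) cB pA) := by
  rcases lt_or_ge pA pB with h | h
  · exact (uB_lt_uB_zero_or_le_hatPayoff_of_lt hcB0 hcB1 hRA hpA h hm).imp_right
      (And.intro (h.trans_le hm))
  rcases le_or_gt (2 * (m - pA)) (bidLength RA (pA - pB)) with hy | hy
  · exact .inl (uB_lt_uB_zero hcB0 hcB1 hRA hpB h hm hy)
  · have hlt := uB_lt_hatPayoff hcB0 hcB1 hRA h hy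
    have := bidLength_pos (p := pA - pB) hRA
    exact .inr ⟨by linarith, hlt.le, fun h' => absurd h' hlt.ne⟩

lemma bidLength_pHatB (hcB0 : 0 < cB) (hcB1 : cB < 1) (hm : pA ≤ m) :
    bidLength (cB * m - cB * pHatB (cB * m) cB pA) (pHatB (cB * m) cB pA - pA) =
      2 * cB * (m - pA) / (2 - cB) := by
  have hden : 2 - cB ≠ 0 := by linarith
  have hsquare : (cB * m - cB * pHatB (cB * m) cB pA) * (cB * m - cB * pHatB (cB * m) cB pA +
      2 * (pHatB (cB * m) cB pA - pA)) = (cB * (m - pA)) ^ 2 := by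
    rw [pHatB_mul_eq hcB0.ne' (by linarith)]
    field_simp
    ring
  rw [bidLength, hsquare, Real.sqrt_sq (mul_nonneg hcB0.le (sub_nonneg.2 hm)),
    pHatB_mul_eq hcB0.ne' (by linarith)]
  field_simp
  ring

lemma one_sub_div_bidLength_pHatB (hcB0 : 0 < cB) (hcB1 : cB < 1) (hm : pA < m) :
    1 - RA / (pHatB (cB * m) cB pA - pA +
      bidLength (cB * m - cB * pHatB (cB * m) cB pA) (pHatB (cB * m) cB pA - pA)) =
        hatPayoff cB RA (m - pA) := by
  rw [bidLength_pHatB hcB0 hcB1 hm.le, pHatB_mul_eq hcB0.ne' (by linarith), hatPayoff]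
  have hsum : pA + 2 * (1 - cB) * (m - pA) / (2 - cB) - pA + 2 * cB * (m - pA) / (2 - cB) =
      2 * (m - pA) / (2 - cB) := by ring
  rw [hsum, div_div_eq_mul_div]

lemma uB_pHatB (hcB0 : 0 < cB) (hcB1 : cB < 1) (hRA : 0 < RA) (hm : RA ≤ m - pA) :
    uB RA (cB * m) cB pA (pHatB (cB * m) cB pA) = hatPayoff cB RA (m - pA) := by
  have hlt : pA < m := by linarith
  obtain ⟨hp, hp'⟩ := pHatB_mem_Ioo hcB0 hcB1 hlt
  have hweak : RA ≤ pHatB (cB * m) cB pA - pA + bidLength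
      (cB * m - cB * pHatB (cB * m) cB pA) (pHatB (cB * m) cB pA - pA) / 2 := by
    have hden : 2 - cB ≠ 0 := by linarith
    rw [bidLength_pHatB hcB0 hcB1 hlt.le, pHatB_mul_eq hcB0.ne' (by linarith)]
    refine hm.trans_eq ?_
    field_simp
    ring
  rw [uB_of_lt hRA hp (by nlinarith), underdogPayoff, if_pos hweak,
    one_sub_div_bidLength_pHatB hcB0 hcB1 hlt]

lemma uB1A_eq (hRA : 0 < RA) (h : pB ≤ pA) :
    uB1A RA MB cB pA pB = (MB - cB * pB) / (pA - pB + bidLength RA (pA - pB)) := by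
  have hℓ : 0 < bidLength RA (pA - pB) := bidLength_pos hRA
  have hp := sub_nonneg.2 h
  change (MB - cB * pB) / (2 * RA) *
    (bidLength RA (pA - pB) / (pA - pB + bidLength RA (pA - pB))) ^ 2 = _
  rw [div_pow, bidLength_sq hRA.le hp]
  field_simp
  ring

lemma uB1B_eq (h : pA < pB) (hRB : 0 ≤ MB - cB * pB) :
    uB1B RA MB cB pA pB = 1 - RA / (pB - pA + bidLength (MB - cB * pB) (pB - pA)) := by
  have hq := sub_pos.2 h
  have hRBq : 0 ≤ MB - cB * pB + 2 * (pB - pA) := by positivity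
  have hprod : fB MB cB pB * (fB MB cB pB + gB MB cB pA pB) =
      bidLength (MB - cB * pB) (pB - pA) := by
    rw [bidLength, Real.sqrt_mul hRB, fB, gB, mul_add, Real.mul_self_sqrt hRB]
  have hsq : (fB MB cB pB + gB MB cB pA pB) ^ 2 =
      2 * (pB - pA + bidLength (MB - cB * pB) (pB - pA)) := by
    rw [← hprod, fB, gB]
    linear_combination Real.sq_sqrt hRBq - Real.sq_sqrt hRB
  have : 0 < pB - pA + bidLength (MB - cB * pB) (pB - pA) :=
    add_pos_of_pos_of_nonneg hq (bidLength_nonneg hRB)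
  rw [uB1B, hprod, div_pow, hsq]
  field_simp

lemma isThreshold_iff (hcB0 : 0 < cB) (hcB1 : cB < 1) (hRA : 0 < RA) (hpA : 0 ≤ pA) :
    IsThreshold RA cB pA m ↔ m - pA ∈ Set.Ioo RA (bidLength RA pA / 2) ∧
      payoffGap cB RA (bidLength RA pA) (m - pA) = 0 := by
  have hmem : m ∈ thresholdInterval RA pA ↔ m - pA ∈ Set.Ioo RA (bidLength RA pA / 2) := by
    rw [Set.mem_Ioo, lt_sub_iff_add_lt, sub_lt_iff_lt_add']
    rfl
  rw [IsThreshold, hmem]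
  refine and_congr_right fun hy => ?_
  have hy0 : 0 < m - pA := hRA.trans hy.1
  obtain ⟨hp, hp'⟩ := pHatB_mem_Ioo hcB0 hcB1 (sub_pos.1 hy0)
  have h1A : uB1A RA (cB * m) cB pA 0 = weakPayoff cB RA (m - pA) (bidLength RA pA) := by
    rw [uB1A_eq hRA hpA, ← div_add_bidLength_eq_weakPayoff hRA hpA]
    simp
  have h1B : uB1B RA (cB * m) cB pA (pHatB (cB * m) cB pA) = hatPayoff cB RA (m - pA) := by
    rw [uB1B_eq hp (by nlinarith), one_sub_div_bidLength_pHatB hcB0 hcB1 (sub_pos.1 hy0)]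
  rw [h1A, h1B, eq_comm, ← sub_eq_zero,
    hatPayoff_sub_weakPayoff hy0.ne' (bidLength_pos hRA).ne', div_eq_zero_iff]
  simp [hy0.ne']

lemma existsUnique_isThreshold (hcB0 : 0 < cB) (hcB1 : cB < 1) (hRA : 0 < RA) (hpA : 0 < pA) :
    ∃! m, IsThreshold RA cB pA m := by
  have hL : 2 * RA < bidLength RA pA := by
    rw [← bidLength_zero_right hRA.le]
    exact bidLength_lt_bidLength hRA le_rfl hpA
  simp only [isThreshold_iff hcB0 hcB1 hRA hpA.le]
  exact (Equiv.subRight pA).bijective.existsUnique_iff.1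
    (existsUnique_payoffGap_eq_zero hcB0 hcB1 hRA hL)

lemma bestResponseB_mul_eq {v : ℝ} {t : Set ℝ} (hcB : cB ≠ 0) (hts : t ⊆ Set.Icc 0 m)
    (ht : t.Nonempty) (heq : ∀ pB ∈ t, uB RA (cB * m) cB pA pB = v)
    (hlt : ∀ pB ∈ Set.Icc 0 m \ t, uB RA (cB * m) cB pA pB < v) :
    bestResponseB RA (cB * m) cB pA = t := by
  rw [bestResponseB, mul_div_cancel_left₀ _ hcB]
  exact setOf_isMaxOn_eq hts ht heq hlt

lemma bestResponseB_of_lt (hcB0 : 0 < cB) (hcB1 : cB < 1) (hRA : 0 < RA) (hpA : 0 < pA)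
    (hh : IsThreshold RA cB pA h) (hm0 : 0 ≤ m) (hmh : m < h) :
    bestResponseB RA (cB * m) cB pA = {0} := by
  obtain ⟨hhℓ, hzero⟩ := (isThreshold_iff hcB0 hcB1 hRA hpA.le).1 hh
  have hℓ := bidLength_pos (p := pA) hRA
  have hyh : m - pA < h - pA := by linarith
  have hu0 : uB RA (cB * m) cB pA 0 = weakPayoff cB RA (m - pA) (bidLength RA pA) := by
    simpa using uB_eq_weakPayoff hcB0.le hcB1.le hRA hpA.le hm0 (by
      rw [sub_zero]
      linarith [hhℓ.2])
  have hgap : payoffGap cB RA (bidLength RA pA) (m - pA) < 0 := hzero ▸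
    payoffGap_strictMonoOn hcB0 hcB1 hRA hℓ (hyh.trans hhℓ.2).le hhℓ.2.le hyh
  refine bestResponseB_mul_eq hcB0.ne' (by simpa using hm0) (Set.singleton_nonempty 0)
    (fun _ => congrArg _) fun pB ⟨hpB, hpB0⟩ => ?_
  have hpB_pos : 0 < pB := hpB.1.lt_of_ne' hpB0
  rcases uB_lt_uB_zero_or_le_hatPayoff hcB0 hcB1 hRA hpA hpB_pos hpB.2 with hlt | ⟨hAm, hle, -⟩
  · exact hlt
  · have hy := sub_pos.2 hAm
    refine hle.trans_lt ?_
    rw [hu0, ← sub_neg, hatPayoff_sub_weakPayoff hy.ne' hℓ.ne']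
    exact div_neg_of_neg_of_pos hgap (by positivity)

lemma uB_zero_lt_hatPayoff (hcB0 : 0 < cB) (hcB1 : cB < 1) (hRA : 0 < RA) (hpA : 0 < pA)
    (hh : IsThreshold RA cB pA h) (hhm : h < m) :
    uB RA (cB * m) cB pA 0 < hatPayoff cB RA (m - pA) := by
  obtain ⟨hhℓ, hzero⟩ := (isThreshold_iff hcB0 hcB1 hRA hpA.le).1 hh
  have hℓ := bidLength_pos (p := pA) hRA
  have hhy : h - pA < m - pA := by linarith
  have hy : 0 < m - pA := by linarith [hhℓ.1]
  rcases le_or_gt (2 * (m - pA)) (bidLength RA pA) with hweak | hstrong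
  · have hgap : 0 < payoffGap cB RA (bidLength RA pA) (m - pA) := hzero ▸
      payoffGap_strictMonoOn hcB0 hcB1 hRA hℓ hhℓ.2.le (by
        rw [Set.mem_Iic]
        linarith) hhy
    rw [uB_eq_weakPayoff hcB0.le hcB1.le hRA hpA.le (by linarith) (by simpa using hweak), sub_zero,
      ← sub_pos, hatPayoff_sub_weakPayoff hy.ne' hℓ.ne']
    positivity
  · exact uB_lt_hatPayoff hcB0 hcB1 hRA hpA.le (by simpa using hstrong)

lemma bestResponseB_of_gt (hcB0 : 0 < cB) (hcB1 : cB < 1) (hRA : 0 < RA) (hpA : 0 < pA)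
    (hh : IsThreshold RA cB pA h) (hhm : h < m) :
    bestResponseB RA (cB * m) cB pA = {pHatB (cB * m) cB pA} := by
  have hRAm : RA ≤ m - pA := by
    linarith [((isThreshold_iff hcB0 hcB1 hRA hpA.le).1 hh).1.1]
  obtain ⟨hp, hp'⟩ := pHatB_mem_Ioo hcB0 hcB1 (by linarith : pA < m)
  have hu0 := uB_zero_lt_hatPayoff hcB0 hcB1 hRA hpA hh hhm
  refine bestResponseB_mul_eq (v := hatPayoff cB RA (m - pA)) hcB0.ne'
    (Set.singleton_subset_iff.2 ⟨by linarith, hp'.le⟩)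
    (Set.singleton_nonempty _) (fun pB hpB => hpB ▸ uB_pHatB hcB0 hcB1 hRA hRAm)
    fun pB ⟨hpB, hpB_ne⟩ => ?_
  rcases hpB.1.eq_or_lt with rfl | hpB0
  · exact hu0
  rcases uB_lt_uB_zero_or_le_hatPayoff hcB0 hcB1 hRA hpA hpB0 hpB.2 with hlt | ⟨-, hle, heq⟩
  · exact hlt.trans hu0
  · exact hle.lt_of_ne fun h' => hpB_ne (heq h')

lemma bestResponseB_of_eq (hcB0 : 0 < cB) (hcB1 : cB < 1) (hRA : 0 < RA) (hpA : 0 < pA)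
    (hh : IsThreshold RA cB pA h) :
    bestResponseB RA (cB * h) cB pA = {0, pHatB (cB * h) cB pA} := by
  obtain ⟨hhℓ, hzero⟩ := (isThreshold_iff hcB0 hcB1 hRA hpA.le).1 hh
  have hℓ := bidLength_pos (p := pA) hRA
  have hy : 0 < h - pA := hRA.trans hhℓ.1
  obtain ⟨hp, hp'⟩ := pHatB_mem_Ioo hcB0 hcB1 (sub_pos.1 hy)
  have hu0 : uB RA (cB * h) cB pA 0 = hatPayoff cB RA (h - pA) := by
    rw [uB_eq_weakPayoff hcB0.le hcB1.le hRA hpA.le (by linarith) (by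
      rw [sub_zero]
      linarith [hhℓ.2]), sub_zero, eq_comm, ← sub_eq_zero,
      hatPayoff_sub_weakPayoff hy.ne' hℓ.ne', hzero, zero_div]
  refine bestResponseB_mul_eq (v := hatPayoff cB RA (h - pA)) hcB0.ne'
    (Set.pair_subset ⟨le_rfl, by linarith⟩ ⟨by linarith, hp'.le⟩)
    (Set.insert_nonempty _ _) ?_ fun pB ⟨hpB, hpB_ne⟩ => ?_
  · rintro pB (rfl | rfl)
    exacts [hu0, uB_pHatB hcB0 hcB1 hRA hhℓ.1.le]
  · rw [Set.mem_insert_iff, Set.mem_singleton_iff, not_or] at hpB_ne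
    have hpB0 : 0 < pB := hpB.1.lt_of_ne' hpB_ne.1
    rcases uB_lt_uB_zero_or_le_hatPayoff hcB0 hcB1 hRA hpA hpB0 hpB.2 with hlt | ⟨-, hle, heq⟩
    · exact hlt.trans_eq hu0
    · exact hle.lt_of_ne fun h' => hpB_ne.2 (heq h')

end Stackelberg

end GeneralLotto

theorem mainTheorem6 (cB RA pA : ℝ) (hcB0 : 0 < cB) (hcB1 : cB < 1) (hRA : 0 < RA)
    (hpA : 0 < pA) :
    ∃ h : ℝ, GeneralLotto.IsThreshold RA cB pA h ∧
      (∀ m : ℝ, GeneralLotto.IsThreshold RA cB pA m → m = h) ∧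
      ∀ MB : ℝ, 0 ≤ MB →
        (∀ pB ∈ Set.Icc 0 (MB / cB),
          ∃! v : ℝ, GeneralLotto.IsEquilibriumPayoffA (pA - pB) RA (MB - cB * pB) v) ∧
        (MB / cB < h → GeneralLotto.bestResponseB RA MB cB pA = {0}) ∧
        (h < MB / cB →
          GeneralLotto.bestResponseB RA MB cB pA = {GeneralLotto.pHatB MB cB pA}) ∧
        (MB / cB = h →
          GeneralLotto.bestResponseB RA MB cB pA = {0, GeneralLotto.pHatB MB cB pA}) := by
  obtain ⟨h, hh, hunique⟩ := GeneralLotto.existsUnique_isThreshold hcB0 hcB1 hRA hpA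
  refine ⟨h, hh, hunique, fun MB hMB => ?_⟩
  obtain ⟨m, rfl⟩ : ∃ m, MB = cB * m := ⟨MB / cB, (mul_div_cancel₀ MB hcB0.ne').symm⟩
  have hm : 0 ≤ m := nonneg_of_mul_nonneg_right hMB hcB0
  rw [mul_div_cancel_left₀ m hcB0.ne']
  refine ⟨fun pB hpB => GeneralLotto.existsUnique_isEquilibriumPayoffA (pA - pB) hRA ?_,
    GeneralLotto.bestResponseB_of_lt hcB0 hcB1 hRA hpA hh hm,
    GeneralLotto.bestResponseB_of_gt hcB0 hcB1 hRA hpA hh, ?_⟩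
  · rw [← mul_sub]
    exact mul_nonneg hcB0.le (sub_nonneg.2 hpB.2)
  · rintro rfl
    exact GeneralLotto.bestResponseB_of_eq hcB0 hcB1 hRA hpA hh
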